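/- Let $t=(t_1,t_2,\dots)$ and $t'=(t'_1,t'_2,\dots)$ be independent formal parameters. Let $\Lambda^{\frac\infty2}V$ be the complex vector space with orthonormal basis $v_S=\underline{s_1}\wedge\underline{s_2}\wedge\cdots$, where $S=\{s_1>s_2>\cdots\}\subset\mathbb Z+\frac12$ runs over the sets for which $S\setminus\{-\frac12,-\frac32,\dots\}$ and $\{-\frac12,-\frac32,\dots\}\setminus S$ are finite. Let $\psi_k f=\underline k\wedge f$ for $k\in\mathbb Z+\frac12$, let $\psi_k^*$ be the adjoint operator, let $v_\emptyset=\underline{-\tfrac12}\wedge\underline{-\tfrac32}\wedge\cdots$, and put $\alpha_n=\sum_{k\in\mathbb Z+\frac12}\psi_{k-n}\psi_k^*$ for $n\neq0$. Consider the following formal power series in $t,t'$ with operator coefficients: $$\Gamma_+(t)=\exp\Big(\sum_{n\ge1}t_n\alpha_n\Big),\qquad \Gamma_-(t')=\exp\Big(\sum_{n\ge1}t'_n\alpha_{-n}\Big),\qquad G=\Gamma_+(t)\,\Gamma_-(t')^{-1}.$$ For $i,j\in\mathbb Z+\frac12$ define the kernel $K(i,j)=\big(G\psi_iG^{-1}\,G\psi_j^*G^{-1}\,v_\emptyset,v_\emptyset\big)\in\mathbb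 C[[t,t']]$, and form the two-sided formal series $$\mathsf K(z,w)=\sum_{i,j\in\mathbb Z+\frac12}z^i\,w^{-j}\,K(i,j),\qquad J(z)=\exp\Big(\sum_{k\ge1}t_kz^k-\sum_{k\ge1}t'_kz^{-k}\Big).$$ Then, as formal series in $z^{\pm1/2}$, $w^{\pm1/2}$ with coefficients in $\mathbb C[[t,t']]$, $$\frac{\partial}{\partial t_1}\mathsf K(z,w)=\sqrt{zw}\;\frac{J(z)}{J(w)}\qquad\text{and}\qquad \frac{\partial}{\partial t'_1}\mathsf K(z,w)=\frac1{\sqrt{zw}}\;\frac{J(z)}{J(w)}.$$ -/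

import Mathlib

noncomputable section

namespace SchurMeasure

/-! ### The infinite wedge space -/

/-- The set `ℤ + 1/2` of half-integers. -/
def HalfInt : Type := {q : ℚ // ∃ n : ℤ, q = n + 1 / 2}

/-- The translate `k - n` of a half-integer `k` by an integer `n`. -/
def HalfInt.subInt (k : HalfInt) (n : ℤ) : HalfInt :=
  ⟨k.1 - n, by
    obtain ⟨q, m, rfl⟩ := k
    exact ⟨m - n, by push_cast; ring⟩⟩

/-- The part of `S` outside `{-1/2, -3/2, -5/2, …}`. -/
def positivePart (S : Set HalfInt) : Set HalfInt := {k | k ∈ S ∧ 0 < k.1}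

/-- The part of `{-1/2, -3/2, -5/2, …}` outside `S`. -/
def negativePart (S : Set HalfInt) : Set HalfInt := {k | k.1 < 0 ∧ k ∉ S}

/-- The subsets `S = {s₁ > s₂ > s₃ > …}` of `ℤ + 1/2` for which both `S₊` and `S₋` are finite. -/
def WedgeIndex : Type :=
  {S : Set HalfInt // (positivePart S).Finite ∧ (negativePart S).Finite}

/-- The half-infinite wedge space: the complex vector space with basis
`v_S = s₁ ∧ s₂ ∧ s₃ ∧ …`. -/
abbrev Wedge : Type := WedgeIndex →₀ ℂ

/-- The basis vector `v_S`. -/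
def basisVec (S : WedgeIndex) : Wedge := Finsupp.single S 1

/-- The inner product in which the vectors `v_S` are orthonormal (linear on the left). -/
def wedgeInner (f g : Wedge) : ℂ := f.sum fun S c => c * star (g S)

/-- `S ∪ {k}`. -/
def WedgeIndex.insert (k : HalfInt) (S : WedgeIndex) : WedgeIndex :=
  ⟨Insert.insert k S.1, by
    refine ⟨(S.2.1.insert k).subset ?_, S.2.2.subset ?_⟩
    · rintro x ⟨hx, hp⟩
      rcases hx with rfl | hx
      · exact Or.inl rfl
      · exact Or.inr ⟨hx, hp⟩
    · rintro x ⟨hp, hx⟩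
      exact ⟨hp, fun h => hx (Or.inr h)⟩⟩

/-- `S \ {k}`. -/
def WedgeIndex.erase (k : HalfInt) (S : WedgeIndex) : WedgeIndex :=
  ⟨S.1 \ {k}, by
    refine ⟨S.2.1.subset ?_, (S.2.2.insert k).subset ?_⟩
    · rintro x ⟨hx, hp⟩
      exact ⟨hx.1, hp⟩
    · rintro x ⟨hp, hx⟩
      by_cases h : x = k
      · exact Or.inl h
      · exact Or.inr ⟨hp, fun hS => hx ⟨hS, h⟩⟩⟩

/-- The sign `(-1)^{#{s ∈ S : s > k}}` produced by moving `k` into its place in the wedge. -/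
def wedgeSign (k : HalfInt) (S : WedgeIndex) : ℂ :=
  (-1) ^ Set.ncard {s : HalfInt | s ∈ S.1 ∧ k.1 < s.1}

open scoped Classical in
/-- The operator `ψ_k`, exterior multiplication `f ↦ k ∧ f`. -/
def psi (k : HalfInt) : Module.End ℂ Wedge :=
  Finsupp.linearCombination ℂ fun S : WedgeIndex =>
    if k ∈ S.1 then (0 : Wedge) else wedgeSign k S • basisVec (S.insert k)

open scoped Classical in
/-- The operator `ψ*_k`, adjoint to `ψ_k` (see `wedgeInner_psi`). -/
def psiStar (k : HalfInt) : Module.End ℂ Wedge :=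
  Finsupp.linearCombination ℂ fun S : WedgeIndex =>
    if k ∈ S.1 then wedgeSign k S • basisVec (S.erase k) else (0 : Wedge)

/-- The vacuum vector `v_∅ = -1/2 ∧ -3/2 ∧ -5/2 ∧ …`. -/
def vacuum : Wedge :=
  basisVec ⟨{k | k.1 < 0}, by
    constructor
    · convert Set.finite_empty using 1
      ext k
      refine iff_of_false ?_ (Set.notMem_empty k)
      rintro ⟨h, h'⟩
      exact lt_asymm h h'
    · convert Set.finite_empty using 1
      ext k
      simp [negativePart]⟩

/-- The operator `α_n = ∑_{k ∈ ℤ + 1/2} ψ_{k-n} ψ*_k` for `n ≠ 0`; applied to a basis vector, the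
sum has finitely many nonzero terms (see `alpha_support_finite`). -/
def alpha (n : ℤ) : Module.End ℂ Wedge :=
  Finsupp.linearCombination ℂ fun S : WedgeIndex =>
    ∑ᶠ k : HalfInt, psi (k.subInt n) (psiStar k (basisVec S))

/-! ### Formal power series in the parameters `t` and `t'` -/

/-- The names of the formal parameters: `Sum.inl n` is `t_n` and `Sum.inr n` is `t'_n`. -/
abbrev Param : Type := ℕ+ ⊕ ℕ+

open scoped Classical in
/-- The linear series `∑_{n ≥ 1} a_n t_n + ∑_{n ≥ 1} b_n t'_n` with coefficients in `R`. -/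
def linearSeries {R : Type*} [Ring R] (a b : ℕ+ → R) : MvPowerSeries Param R := fun m =>
  ∑ᶠ p : Param, if m = Finsupp.single p 1 then Sum.elim a b p else 0

/-- The exponential `∑_k X^k / k!` of a formal power series `X` in the parameters without constant
term: since `X^k` only has terms of total degree at least `k`, the terms with `k` at most the total
degree of the monomial `m` are those which contribute to the coefficient of `m`. -/
def formalExp {R : Type*} [Ring R] [Algebra ℂ R] (X : MvPowerSeries Param R) :
    MvPowerSeries Param R := fun m =>
  ∑ k ∈ Finset.range (m.degree + 1), ((k.factorial : ℂ)⁻¹) • MvPowerSeries.coeff m (X ^ k)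

/-! ### Vertex operators and the kernel -/

/-- Formal power series in `t` and `t'` whose coefficients are operators on the wedge space. -/
abbrev OpSeries : Type := MvPowerSeries Param (Module.End ℂ Wedge)

/-- `Γ₊(t) = exp (∑_{n ≥ 1} t_n α_n)`. -/
def GammaPlus : OpSeries := formalExp (linearSeries (fun n => alpha (n : ℤ)) 0)

/-- `Γ₋(t') = exp (∑_{n ≥ 1} t'_n α_{-n})`. -/
def GammaMinus : OpSeries := formalExp (linearSeries 0 (fun n => alpha (-(n : ℤ))))

/-- `G = Γ₊(t) Γ₋(t')⁻¹`. -/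
def G : OpSeries := GammaPlus * Ring.inverse GammaMinus

/-- `Ψ_k = G ψ_k G⁻¹`. -/
def Psi (k : HalfInt) : OpSeries := G * MvPowerSeries.C (psi k) * Ring.inverse G

/-- `Ψ*_k = G ψ*_k G⁻¹`. -/
def PsiStar (k : HalfInt) : OpSeries := G * MvPowerSeries.C (psiStar k) * Ring.inverse G

/-- The vacuum expectation `(A v_∅, v_∅)`, a formal power series in `t` and `t'`. -/
def vacuumExpectation (A : OpSeries) : MvPowerSeries Param ℂ := fun m =>
  wedgeInner (MvPowerSeries.coeff m A vacuum) vacuum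

/-- The kernel `K(i,j) = (Ψ_i Ψ*_j v_∅, v_∅)`. -/
def K (i j : HalfInt) : MvPowerSeries Param ℂ := vacuumExpectation (Psi i * PsiStar j)

/-! ### Formal series in `z` and `w` -/

/-- Formal two-sided infinite series in rational powers of `z` and `w`, whose coefficients are
formal power series in `t` and `t'`; the value at `(a, b)` is the coefficient of `z^a w^b`. -/
abbrev TwoSidedSeries : Type := ℚ × ℚ → MvPowerSeries Param ℂ

open scoped Classical in
/-- The generating function `𝖪(z,w) = ∑_{i,j ∈ ℤ + 1/2} z^i w^{-j} K(i,j)`. -/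
def kernelGF : TwoSidedSeries := fun e =>
  ∑ᶠ ij : HalfInt × HalfInt, if e = (ij.1.1, -ij.2.1) then K ij.1 ij.2 else 0

/-- The partial derivative of a two-sided series with respect to the parameter `p`, taken
coefficient by coefficient. -/
def paramDeriv (p : Param) (F : TwoSidedSeries) : TwoSidedSeries := fun e =>
  MvPowerSeries.pderiv ℂ p (F e)

/-- Finite linear combinations of monomials `z^a w^b` with rational exponents. -/
abbrev LaurentZW : Type := AddMonoidAlgebra ℂ (ℚ × ℚ)

/-- The monomial `z^a w^b`. -/
def monomialZW (a b : ℚ) : LaurentZW := AddMonoidAlgebra.single (a, b) 1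

/-- Regard a power series in `t` and `t'` with coefficients that are finite combinations of
monomials `z^a w^b` as a two-sided series in `z` and `w`. -/
def toTwoSided (f : MvPowerSeries Param LaurentZW) : TwoSidedSeries := fun e m =>
  (MvPowerSeries.coeff m f).coeff e

/-- `J(z) = exp (∑_{k ≥ 1} t_k z^k - ∑_{k ≥ 1} t'_k z^{-k})`. -/
def Jz : MvPowerSeries Param LaurentZW :=
  formalExp (linearSeries (fun k => monomialZW (k : ℕ) 0) (fun k => -monomialZW (-(k : ℕ)) 0))

/-- `J(w) = exp (∑_{k ≥ 1} t_k w^k - ∑_{k ≥ 1} t'_k w^{-k})`. -/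
def Jw : MvPowerSeries Param LaurentZW :=
  formalExp (linearSeries (fun k => monomialZW 0 (k : ℕ)) (fun k => -monomialZW 0 (-(k : ℕ))))

/-! ### Sanity checks for the definitions -/

theorem constantCoeff_formalExp {R : Type*} [Ring R] [Algebra ℂ R] (X : MvPowerSeries Param R) :
    MvPowerSeries.constantCoeff (formalExp X) = 1 := by
  rw [← MvPowerSeries.coeff_zero_eq_constantCoeff_apply]
  change formalExp X 0 = 1
  simp [formalExp]

/-- Every exponential is invertible, so the inverses above are genuine two-sided inverses. -/
theorem isUnit_formalExp {R : Type*} [Ring R] [Algebra ℂ R] (X : MvPowerSeries Param R) :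
    IsUnit (formalExp X) := by
  rw [MvPowerSeries.isUnit_iff_constantCoeff, constantCoeff_formalExp]
  exact isUnit_one

theorem isUnit_G : IsUnit G :=
  (isUnit_formalExp _).mul (isUnit_formalExp _).ringInverse

theorem wedgeInner_basisVec (f : Wedge) (S : WedgeIndex) :
    wedgeInner f (basisVec S) = f S := by
  classical
  unfold wedgeInner basisVec Finsupp.sum
  simp [Finsupp.single_apply]
  tauto

theorem wedgeInner_single_left (S : WedgeIndex) (c : ℂ) (g : Wedge) :
    wedgeInner (Finsupp.single S c) g = c * star (g S) := by
  simp [wedgeInner]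

theorem wedgeInner_add_left (f f' g : Wedge) :
    wedgeInner (f + f') g = wedgeInner f g + wedgeInner f' g := by
  unfold wedgeInner
  exact Finsupp.sum_add_index' (by simp) (by intros; ring)

theorem wedgeInner_smul_left (c : ℂ) (f g : Wedge) :
    wedgeInner (c • f) g = c * wedgeInner f g := by
  unfold wedgeInner
  rw [Finsupp.sum_smul_index' (by simp), Finsupp.mul_sum]
  simp [mul_assoc]

theorem wedgeInner_zero_left (g : Wedge) : wedgeInner 0 g = 0 := by
  simp [wedgeInner]

theorem psi_basisVec_of_mem {k : HalfInt} {S : WedgeIndex} (h : k ∈ S.1) :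
    psi k (basisVec S) = 0 := by
  simp [psi, basisVec, h]

theorem psi_basisVec_of_notMem {k : HalfInt} {S : WedgeIndex} (h : k ∉ S.1) :
    psi k (basisVec S) = wedgeSign k S • basisVec (S.insert k) := by
  simp [psi, basisVec, h]

theorem psiStar_basisVec_of_mem {k : HalfInt} {S : WedgeIndex} (h : k ∈ S.1) :
    psiStar k (basisVec S) = wedgeSign k S • basisVec (S.erase k) := by
  simp [psiStar, basisVec, h]

theorem psiStar_basisVec_of_notMem {k : HalfInt} {S : WedgeIndex} (h : k ∉ S.1) :
    psiStar k (basisVec S) = 0 := by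
  simp [psiStar, basisVec, h]

theorem wedgeSign_insert (k : HalfInt) (S : WedgeIndex) :
    wedgeSign k (S.insert k) = wedgeSign k S := by
  unfold wedgeSign
  congr 2
  ext s
  constructor
  · rintro ⟨h | h, hk⟩
    · exact absurd hk (by rw [h]; exact lt_irrefl _)
    · exact ⟨h, hk⟩
  · rintro ⟨h, hk⟩
    exact ⟨Or.inr h, hk⟩

theorem insert_eq_iff {k : HalfInt} {S T : WedgeIndex} :
    (k ∉ S.1 ∧ S.insert k = T) ↔ (k ∈ T.1 ∧ T.erase k = S) := by
  constructor
  · rintro ⟨h, rfl⟩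
    refine ⟨Or.inl rfl, Subtype.ext (Set.ext fun x => ?_)⟩
    constructor
    · rintro ⟨hx | hx, hn⟩
      · exact absurd hx hn
      · exact hx
    · intro hx
      exact ⟨Or.inr hx, fun hk => h (by rw [← show x = k from hk]; exact hx)⟩
  · rintro ⟨h, rfl⟩
    refine ⟨fun hk => hk.2 rfl, Subtype.ext (Set.ext fun x => ?_)⟩
    constructor
    · rintro (hx | hx)
      · rw [hx]
        exact h
      · exact hx.1
    · intro hx
      by_cases hk : x = k
      · exact Or.inl hk
      · exact Or.inr ⟨hx, hk⟩

/-- `ψ*_k` is the adjoint of `ψ_k`. -/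
theorem wedgeInner_psi (k : HalfInt) (f g : Wedge) :
    wedgeInner (psi k f) g = wedgeInner f (psiStar k g) := by
  classical
  have star_sign : ∀ S : WedgeIndex, star (wedgeSign k S) = wedgeSign k S := by
    intro S
    simp [wedgeSign]
  have coeff : ∀ S : WedgeIndex, star (wedgeInner (psi k (basisVec S)) g) = psiStar k g S := by
    intro S
    induction g using Finsupp.induction_linear with
    | zero => simp [wedgeInner]
    | add g g' hg hg' =>
      rw [map_add, Finsupp.add_apply, ← hg, ← hg', ← star_add]
      congr 1
      unfold wedgeInner Finsupp.sum
      simp [mul_add, Finset.sum_add_distrib]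
    | single T c =>
      have hT : (Finsupp.single T c : Wedge) = c • basisVec T := by simp [basisVec]
      rw [hT, map_smul]
      by_cases hS : k ∈ S.1
      · rw [psi_basisVec_of_mem hS, wedgeInner_zero_left, star_zero]
        by_cases hk : k ∈ T.1
        · rw [psiStar_basisVec_of_mem hk]
          have : T.erase k ≠ S := fun h => (insert_eq_iff.mpr ⟨hk, h⟩).1 hS
          simp [basisVec, this]
        · simp [psiStar_basisVec_of_notMem hk]
      · rw [psi_basisVec_of_notMem hS, wedgeInner_smul_left]
        by_cases hST : S.insert k = T
        · obtain ⟨hk, he⟩ := insert_eq_iff.mp ⟨hS, hST⟩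
          rw [psiStar_basisVec_of_mem hk, he, ← hST, wedgeSign_insert, star_mul, star_sign]
          simp [basisVec, wedgeInner, mul_comm]
        · have hr : psiStar k (basisVec T) S = 0 := by
            by_cases hk : k ∈ T.1
            · rw [psiStar_basisVec_of_mem hk]
              have : T.erase k ≠ S := fun h => hST (insert_eq_iff.mpr ⟨hk, h⟩).2
              simp [basisVec, this]
            · simp [psiStar_basisVec_of_notMem hk]
          rw [Finsupp.smul_apply, hr]
          simp [basisVec, wedgeInner, Ne.symm hST]
  induction f using Finsupp.induction_linear with
  | zero => simp [wedgeInner]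
  | add f f' hf hf' => rw [map_add, wedgeInner_add_left, wedgeInner_add_left, hf, hf']
  | single S c =>
    have hS : (Finsupp.single S c : Wedge) = c • basisVec S := by simp [basisVec]
    rw [wedgeInner_single_left, ← coeff S, star_star, hS, map_smul, wedgeInner_smul_left]

theorem HalfInt.finite_Icc (a b : ℤ) :
    {k : HalfInt | (a : ℚ) < k.1 ∧ k.1 < (b : ℚ)}.Finite := by
  refine ((Set.finite_Icc a b).image
    (fun m : ℤ => (⟨m + 1 / 2, m, rfl⟩ : HalfInt))).subset ?_
  rintro ⟨q, m, rfl⟩ ⟨h1, h2⟩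
  refine ⟨m, ⟨?_, ?_⟩, rfl⟩
  · have : (a : ℚ) < ((m + 1 : ℤ) : ℚ) := by
      push_cast
      dsimp at h1
      linarith
    have := Int.cast_lt.mp this
    omega
  · have : (m : ℚ) < (b : ℚ) := by
      dsimp at h2
      linarith
    exact (Int.cast_lt.mp this).le

/-- The sum which defines `α_n v_S` is finite. -/
theorem alpha_support_finite {n : ℤ} (hn : n ≠ 0) (S : WedgeIndex) :
    {k : HalfInt | psi (k.subInt n) (psiStar k (basisVec S)) ≠ 0}.Finite := by
  have inj : Function.Injective fun k : HalfInt => k.subInt n := by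
    intro k l h
    have := congrArg Subtype.val h
    simp only [HalfInt.subInt, sub_left_inj] at this
    exact Subtype.ext this
  refine ((S.2.1.union (S.2.2.preimage inj.injOn)).union
    (HalfInt.finite_Icc (n - 1) 1)).subset ?_
  intro k hk
  have hkS : k ∈ S.1 := by
    by_contra h
    exact hk (by rw [psiStar_basisVec_of_notMem h, map_zero])
  have hkn : k.subInt n ∉ S.1 := by
    intro h
    refine hk ?_
    rw [psiStar_basisVec_of_mem hkS, map_smul, psi_basisVec_of_mem, smul_zero]
    refine ⟨h, fun he => hn ?_⟩
    have : k.1 - (n : ℚ) = k.1 := congrArg Subtype.val he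
    exact_mod_cast (sub_eq_self.mp this)
  by_cases hp : 0 < k.1
  · exact Or.inl (Or.inl ⟨hkS, hp⟩)
  · by_cases hq : (k.subInt n).1 < 0
    · exact Or.inl (Or.inr ⟨hq, hkn⟩)
    · refine Or.inr ⟨?_, ?_⟩
      · have : (0 : ℚ) ≤ k.1 - n := not_lt.mp hq
        push_cast
        linarith
      · push_cast
        linarith [not_lt.mp hp]

end SchurMeasure

end

noncomputable section

namespace SchurMeasure

/-! Put $\psi(z)=\sum z^i\psi_i$ and $\psi^*(w)=\sum w^{-j}\psi^*_j$. The canonical anticommutation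
relations give $[\alpha_n,\psi(z)]=z^n\psi(z)$ and $[\alpha_n,\psi^*(w)]=-w^n\psi^*(w)$, so
bracketing $\psi(z)\psi^*(w)$ with $\alpha_n$ multiplies it by the scalar $z^n-w^n$
(`alpha_commutator_fermionPairing`). Exponentiating, conjugation by $G$ multiplies it by $J(z)/J(w)$
(`G_mul_C_fermionPairing_one`). No commutation relation among the $\alpha_n$ is needed.

Since $(\psi_i\psi^*_jv_\emptyset,v_\emptyset)$ is $1$ for $i=j<0$ and $0$ otherwise, $\mathsf
K(z,w)=\frac{J(z)}{J(w)}\sum_{i<0}z^iw^{-i}$ (`kernelGF_eq`). Each coefficient of $J(z)/J(w)$ in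
$t,t'$ is a Laurent polynomial, so this product with a two-sided series is meaningful; it is encoded
by linear functionals on Laurent polynomials, one for each exponent of $(z,w)$. Finally
$\partial_{t_1}$ multiplies $J(z)/J(w)$ by $z-w$ and $\partial_{t'_1}$ by $w^{-1}-z^{-1}$, and
either factor makes the geometric sum telescope to one monomial.

Exponentials of non-commuting operators are handled through the Euler operator $E$: for $X$ of
degree one, $\exp X$ is the solution of $EA=XA$ with constant term $1$. -/

open MvPowerSeries

/-! ### Formal exponentials and the Euler operator. -/

section Exponential

variable {R : Type*} [Ring R]

/-- The Euler operator, multiplying each monomial by its total degree. -/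
def euler (F : MvPowerSeries Param R) : MvPowerSeries Param R := fun m => m.degree • coeff m F

theorem coeff_euler (F : MvPowerSeries Param R) (m : Param →₀ ℕ) :
    coeff m (euler F) = m.degree • coeff m F := rfl

theorem euler_mul (A B : MvPowerSeries Param R) :
    euler (A * B) = euler A * B + A * euler B := by
  classical
  ext m
  simp only [coeff_euler, map_add, coeff_mul, Finset.smul_sum, ← Finset.sum_add_distrib]
  refine Finset.sum_congr rfl fun p hp => ?_
  rw [← Finset.HasAntidiagonal.mem_antidiagonal.mp hp, map_add, add_smul, smul_mul_assoc,
    mul_smul_comm]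

/-- Series which are homogeneous of degree one in the parameters. -/
def IsLinearSeries (X : MvPowerSeries Param R) : Prop := ∀ m, m.degree ≠ 1 → coeff m X = 0

theorem IsLinearSeries.add {X Y : MvPowerSeries Param R} (hX : IsLinearSeries X)
    (hY : IsLinearSeries Y) : IsLinearSeries (X + Y) := fun m hm => by
  rw [map_add, hX m hm, hY m hm, add_zero]

theorem IsLinearSeries.coeff_pow {X : MvPowerSeries Param R} (hX : IsLinearSeries X) (k : ℕ)
    (m : Param →₀ ℕ) (hm : m.degree ≠ k) : coeff m (X ^ k) = 0 := by
  classical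
  induction k generalizing m with
  | zero =>
    rw [pow_zero, coeff_one, if_neg]
    rintro rfl
    exact hm (by simp)
  | succ k ih =>
    rw [pow_succ, coeff_mul]
    refine Finset.sum_eq_zero fun p hp => ?_
    by_cases h1 : p.1.degree = k
    · rw [hX p.2, mul_zero]
      intro h2
      rw [← Finset.HasAntidiagonal.mem_antidiagonal.mp hp, map_add, h1, h2] at hm
      exact hm rfl
    · rw [ih p.1 h1, zero_mul]

/-- `X ^ k` is homogeneous of degree `k`, so a single term of the exponential survives. -/
theorem coeff_formalExp [Algebra ℂ R] {X : MvPowerSeries Param R} (hX : IsLinearSeries X)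
    (m : Param →₀ ℕ) :
    coeff m (formalExp X) = ((m.degree.factorial : ℂ)⁻¹) • coeff m (X ^ m.degree) := by
  change ∑ k ∈ Finset.range (m.degree + 1), ((k.factorial : ℂ)⁻¹) • coeff m (X ^ k) = _
  refine Finset.sum_eq_single_of_mem _ (Finset.self_mem_range_succ _) fun k _ hk => ?_
  rw [hX.coeff_pow k m hk.symm, smul_zero]

/-- By homogeneity $E(X^k)=kX^k=X\cdot kX^{k-1}$, even when the coefficients of $X$ do not commute.
-/
theorem euler_formalExp [Algebra ℂ R] {X : MvPowerSeries Param R} (hX : IsLinearSeries X) :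
    euler (formalExp X) = X * formalExp X := by
  classical
  ext m
  rw [coeff_euler, coeff_formalExp hX, coeff_mul]
  have key : ∀ p ∈ Finset.HasAntidiagonal.antidiagonal m, coeff p.1 X * coeff p.2 (formalExp X) =
      (((m.degree - 1).factorial : ℂ)⁻¹) • (coeff p.1 X * coeff p.2 (X ^ (m.degree - 1))) := by
    intro p hp
    by_cases h1 : p.1.degree = 1
    · have h2 : p.2.degree = m.degree - 1 := by
        rw [← Finset.HasAntidiagonal.mem_antidiagonal.mp hp, map_add, h1]
        omega
      rw [coeff_formalExp hX, h2, mul_smul_comm]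
    · rw [hX _ h1, zero_mul, zero_mul, smul_zero]
  rw [Finset.sum_congr rfl key, ← Finset.smul_sum, ← coeff_mul, ← pow_succ']
  -- In degree zero the truncated subtraction leaves `X ^ 1` on the right, which has no constant
  -- term.
  rcases Nat.eq_zero_or_pos m.degree with h | h
  · rw [h, zero_smul, hX.coeff_pow _ m (by omega), smul_zero]
  · obtain ⟨d, hd⟩ : ∃ d, m.degree = d + 1 := ⟨m.degree - 1, by omega⟩
    rw [hd, Nat.add_sub_cancel, ← Nat.cast_smul_eq_nsmul ℂ, smul_smul, Nat.factorial_succ]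
    congr 1
    push_cast
    have : (d : ℂ) + 1 ≠ 0 := Nat.cast_add_one_ne_zero d
    field_simp

/-- The equation `E A = X A` determines `A` by its constant coefficient. -/
theorem eq_of_euler_eq [Algebra ℂ R] {X A B : MvPowerSeries Param R} (hX : IsLinearSeries X)
    (hA : euler A = X * A) (hB : euler B = X * B) (h0 : coeff 0 A = coeff 0 B) : A = B := by
  classical
  have main : ∀ d : ℕ, ∀ m : Param →₀ ℕ, m.degree = d → coeff m A = coeff m B := by
    intro d
    induction d with
    | zero =>
      intro m hm
      rw [(Finsupp.degree_eq_zero_iff m).mp hm, h0]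
    | succ d ih =>
      intro m hm
      have h : m.degree • coeff m A = m.degree • coeff m B := by
        -- As `X` has degree one, the degree `d + 1` part of `X * A` sees `A` only in degree `d`;
        -- the factor `d + 1` is then divided out.
        rw [← coeff_euler, ← coeff_euler, hA, hB, coeff_mul, coeff_mul]
        refine Finset.sum_congr rfl fun p hp => ?_
        by_cases h1 : p.1.degree = 1
        · rw [ih p.2]
          have := congrArg Finsupp.degree (Finset.HasAntidiagonal.mem_antidiagonal.mp hp)
          rw [map_add, h1, hm] at this
          omega
        · rw [hX _ h1, zero_mul, zero_mul]
      rw [hm, ← Nat.cast_smul_eq_nsmul ℂ, ← Nat.cast_smul_eq_nsmul ℂ] at h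
      have hd : ((d + 1 : ℕ) : ℂ) ≠ 0 := Nat.cast_ne_zero.mpr d.succ_ne_zero
      simpa only [inv_smul_smul₀ hd] using congrArg (fun x => ((d + 1 : ℕ) : ℂ)⁻¹ • x) h
  ext m
  exact main _ m rfl

theorem linearSeries_single (a b : ℕ+ → R) (p : Param) :
    coeff (Finsupp.single p 1) (linearSeries a b) = Sum.elim a b p := by
  classical
  change (∑ᶠ q : Param, if Finsupp.single p 1 = Finsupp.single q 1 then Sum.elim a b q else 0) = _
  rw [finsum_eq_single _ p]
  · simp
  · intro q hq
    rw [if_neg]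
    exact fun h => hq (Finsupp.single_left_injective one_ne_zero h).symm

theorem coeff_linearSeries_of_ne (a b : ℕ+ → R) (m : Param →₀ ℕ)
    (hm : ∀ p, m ≠ Finsupp.single p 1) : coeff m (linearSeries a b) = 0 := by
  classical
  change (∑ᶠ q : Param, if m = Finsupp.single q 1 then Sum.elim a b q else 0) = _
  simp [hm]

theorem isLinearSeries_linearSeries (a b : ℕ+ → R) : IsLinearSeries (linearSeries a b) := by
  intro m hm
  refine coeff_linearSeries_of_ne a b m fun p hp => hm ?_
  rw [hp, Finsupp.degree_single]

theorem linearSeries_add (a b a' b' : ℕ+ → R) :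
    linearSeries (a + a') (b + b') = linearSeries a b + linearSeries a' b' := by
  ext m
  by_cases h : ∃ p, m = Finsupp.single p 1
  · obtain ⟨p, rfl⟩ := h
    rw [map_add, linearSeries_single, linearSeries_single, linearSeries_single]
    cases p <;> rfl
  · push Not at h
    rw [map_add, coeff_linearSeries_of_ne _ _ m h, coeff_linearSeries_of_ne _ _ m h,
      coeff_linearSeries_of_ne _ _ m h, add_zero]

end Exponential

/-! ### Products and derivatives of exponentials over a commutative ring. -/

section Commutative

variable {R : Type*} [CommRing R]

theorem formalExp_add [Algebra ℂ R] {X Y : MvPowerSeries Param R} (hX : IsLinearSeries X)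
    (hY : IsLinearSeries Y) : formalExp (X + Y) = formalExp X * formalExp Y := by
  refine eq_of_euler_eq (hX.add hY) (euler_formalExp (hX.add hY)) ?_ ?_
  · rw [euler_mul, euler_formalExp hX, euler_formalExp hY]
    ring
  · simp only [coeff_zero_eq_constantCoeff, map_mul, constantCoeff_formalExp, mul_one]

theorem pderiv_linearSeries (a b : ℕ+ → R) (p : Param) :
    pderiv R p (linearSeries a b) = C (Sum.elim a b p) := by
  classical
  ext m
  rw [coeff_pderiv, coeff_C]
  split_ifs with h
  · rw [h, zero_add, linearSeries_single]
    simp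
  · rw [isLinearSeries_linearSeries a b, zero_mul]
    rw [map_add, Finsupp.degree_single]
    intro h1
    exact h ((Finsupp.degree_eq_zero_iff m).mp (by omega))

/-- Compares coefficients using $\partial_p X^{k+1}=(k+1)\,c\,X^k$ with $k$ the degree of the
monomial. -/
theorem pderiv_formalExp [Algebra ℂ R] {X : MvPowerSeries Param R} (hX : IsLinearSeries X)
    {p : Param} {c : R} (hp : pderiv R p X = C c) : pderiv R p (formalExp X) = C c * formalExp X := by
  ext m
  rw [coeff_pderiv, coeff_formalExp hX, coeff_C_mul, coeff_formalExp hX, map_add,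
    Finsupp.degree_single, smul_mul_assoc]
  have h : coeff (m + Finsupp.single p 1) (X ^ (m.degree + 1)) * (m p + 1) =
      ((m.degree + 1 : ℕ) : ℂ) • (c * coeff m (X ^ m.degree)) := by
    rw [← coeff_pderiv, Derivation.leibniz_pow, hp, Nat.add_sub_cancel, Nat.cast_smul_eq_nsmul,
      map_nsmul, smul_eq_mul, mul_comm _ (C c), coeff_C_mul]
  rw [h, smul_smul, mul_smul_comm, Nat.factorial_succ]
  congr 1
  push_cast
  have : (m.degree : ℂ) + 1 ≠ 0 := Nat.cast_add_one_ne_zero _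
  field_simp

end Commutative

/-! ### From commutators to conjugation by exponentials. -/

section Intertwining

variable {S R : Type*} [CommRing S] [Algebra ℂ S] [Ring R] [Algebra ℂ R]

/-- Apply a linear map to all coefficients. -/
def mapCoeff {S R : Type*} [Semiring S] [Semiring R] [Module ℂ S] [Module ℂ R]
    (θ : S →ₗ[ℂ] R)
    (f : MvPowerSeries Param S) : MvPowerSeries Param R := fun m => θ (coeff m f)

theorem coeff_mapCoeff (θ : S →ₗ[ℂ] R) (f : MvPowerSeries Param S) (m : Param →₀ ℕ) :
    coeff m (mapCoeff θ f) = θ (coeff m f) := rfl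

theorem mapCoeff_C (θ : S →ₗ[ℂ] R) (g : S) : mapCoeff θ (C g) = C (θ g) := by
  classical
  ext m
  rw [coeff_mapCoeff, coeff_C, coeff_C]
  split_ifs
  · rfl
  · exact map_zero θ

theorem euler_mapCoeff (θ : S →ₗ[ℂ] R) (f : MvPowerSeries Param S) :
    euler (mapCoeff θ f) = mapCoeff θ (euler f) := by
  ext m
  rw [coeff_euler, coeff_mapCoeff, coeff_mapCoeff, coeff_euler, map_nsmul]

/-- If `[α_p, θ g] = θ (c_p g)`, then the corresponding linear series satisfy the same relation. -/
theorem linearSeries_mul_mapCoeff (θ : S →ₗ[ℂ] R) (a b : ℕ+ → R) (c d : ℕ+ → S)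
    (h : ∀ p g, Sum.elim a b p * θ g = θ g * Sum.elim a b p + θ (Sum.elim c d p * g))
    (f : MvPowerSeries Param S) :
    linearSeries a b * mapCoeff θ f =
      mapCoeff θ f * linearSeries a b + mapCoeff θ (linearSeries c d * f) := by
  classical
  ext m
  -- `R` is not commutative: only the indices are swapped, so that the degree-one factor is indexed
  -- by the first component in all three sums.
  have swap : coeff m (mapCoeff θ f * linearSeries a b) =
      ∑ q ∈ Finset.HasAntidiagonal.antidiagonal m,
        θ (coeff q.2 f) * coeff q.1 (linearSeries a b) := by
    rw [coeff_mul]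
    refine Finset.sum_equiv (Equiv.prodComm _ _) (fun q => ?_) fun q _ => rfl
    simp only [Finset.HasAntidiagonal.mem_antidiagonal, Equiv.prodComm_apply, Prod.fst_swap,
      Prod.snd_swap, add_comm]
  rw [map_add, swap, coeff_mul, coeff_mapCoeff, coeff_mul, map_sum, ← Finset.sum_add_distrib]
  refine Finset.sum_congr rfl fun q _ => ?_
  rw [coeff_mapCoeff]
  by_cases hq : ∃ p, q.1 = Finsupp.single p 1
  · obtain ⟨p, hp⟩ := hq
    rw [hp, linearSeries_single, linearSeries_single, h]
  · push Not at hq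
    rw [coeff_linearSeries_of_ne _ _ _ hq, coeff_linearSeries_of_ne _ _ _ hq]
    simp

/-- Both sides solve $EA=XA$ with constant term $\theta(g)$. For the right side, with $F=e^{x}g$,
the product rule gives $(\theta(xF)+\theta(F)X)e^X=X\theta(F)e^X$. -/
theorem formalExp_mul_C (θ : S →ₗ[ℂ] R) {X : MvPowerSeries Param R} {x : MvPowerSeries Param S}
    (hX : IsLinearSeries X) (hx : IsLinearSeries x)
    (h : ∀ f, X * mapCoeff θ f = mapCoeff θ f * X + mapCoeff θ (x * f)) (g : S) :
    formalExp X * C (θ g) = mapCoeff θ (formalExp x * C g) * formalExp X := by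
  refine eq_of_euler_eq hX ?_ ?_ ?_
  · have h0 : euler (C (θ g) : MvPowerSeries Param R) = 0 := by
      classical
      ext m
      rw [coeff_euler, coeff_C]
      split_ifs with hm
      · simp [hm]
      · simp
    rw [euler_mul, euler_formalExp hX, h0, mul_zero, add_zero, mul_assoc]
  · have h0 : euler (C g : MvPowerSeries Param S) = 0 := by
      classical
      ext m
      rw [coeff_euler, coeff_C]
      split_ifs with hm
      · simp [hm]
      · simp
    rw [euler_mul, euler_formalExp hX, euler_mapCoeff, euler_mul, euler_formalExp hx, h0, mul_zero,
      add_zero, ← mul_assoc X, h, mul_assoc x, add_mul, mul_assoc _ X, add_comm]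
  · simp only [coeff_zero_eq_constantCoeff, map_mul, constantCoeff_formalExp, one_mul, mul_one,
      constantCoeff_C]
    rw [← coeff_zero_eq_constantCoeff_apply, coeff_mapCoeff, coeff_zero_eq_constantCoeff_apply,
      map_mul, constantCoeff_formalExp, one_mul, constantCoeff_C]

/-- The Euler argument uses $E(g)=0$ and so covers constants only; the parameters being central, the
general case follows by applying it to each coefficient of `f`. -/
theorem formalExp_mul_mapCoeff (θ : S →ₗ[ℂ] R) {X : MvPowerSeries Param R}
    {x : MvPowerSeries Param S} (hX : IsLinearSeries X) (hx : IsLinearSeries x)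
    (h : ∀ f, X * mapCoeff θ f = mapCoeff θ f * X + mapCoeff θ (x * f))
    (f : MvPowerSeries Param S) :
    formalExp X * mapCoeff θ f = mapCoeff θ (formalExp x * f) * formalExp X := by
  classical
  have key : ∀ (d : Param →₀ ℕ) (g : S), coeff d (formalExp X) * θ g =
      ∑ q ∈ Finset.HasAntidiagonal.antidiagonal d,
        θ (coeff q.1 (formalExp x) * g) * coeff q.2 (formalExp X) := by
    intro d g
    have := congrArg (coeff d) (formalExp_mul_C θ hX hx h g)
    rw [coeff_mul_C, coeff_mul] at this
    rw [this]
    refine Finset.sum_congr rfl fun q _ => ?_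
    rw [coeff_mapCoeff, coeff_mul_C]
  ext m
  simp only [coeff_mul, coeff_mapCoeff, key, map_sum, Finset.sum_mul, Finset.sum_sigma']
  -- Both sums run over decompositions `m = u1 + u2 + v`; the involution exchanges `u2` and `v`.
  refine Finset.sum_nbij' (fun s => ⟨(s.2.1 + s.1.2, s.2.2), (s.2.1, s.1.2)⟩)
    (fun s => ⟨(s.2.1 + s.1.2, s.2.2), (s.2.1, s.1.2)⟩) ?_ ?_ ?_ ?_ ?_
  · rintro ⟨⟨u, v⟩, ⟨u1, u2⟩⟩ hs
    simp only [Finset.mem_sigma, Finset.HasAntidiagonal.mem_antidiagonal] at hs ⊢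
    rw [← hs.1, ← hs.2]
    exact ⟨by abel, trivial⟩
  · rintro ⟨⟨u, v⟩, ⟨u1, u2⟩⟩ hs
    simp only [Finset.mem_sigma, Finset.HasAntidiagonal.mem_antidiagonal] at hs ⊢
    rw [← hs.1, ← hs.2]
    exact ⟨by abel, trivial⟩
  · rintro ⟨⟨u, v⟩, ⟨u1, u2⟩⟩ hs
    simp only [Finset.mem_sigma, Finset.HasAntidiagonal.mem_antidiagonal] at hs
    simp [← hs.2]
  · rintro ⟨⟨u, v⟩, ⟨u1, u2⟩⟩ hs
    simp only [Finset.mem_sigma, Finset.HasAntidiagonal.mem_antidiagonal] at hs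
    simp [← hs.2]
  · rintro ⟨⟨u, v⟩, ⟨u1, u2⟩⟩ _
    rfl

end Intertwining

/-! ### Anticommutation relations, commutators with `alpha`, and vacuum expectations. -/

section Fermions

theorem wedge_end_ext {A B : Module.End ℂ Wedge} (h : ∀ S, A (basisVec S) = B (basisVec S)) :
    A = B :=
  Finsupp.lhom_ext' fun S => LinearMap.ext_ring (h S)

theorem wedgeSign_mul_self (k : HalfInt) (S : WedgeIndex) : wedgeSign k S * wedgeSign k S = 1 := by
  unfold wedgeSign
  rw [← mul_pow]
  simp

/-- Needed because `Set.ncard` is zero on infinite sets: only for finite sets does adding an element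
flip the sign. -/
theorem finite_above (k : HalfInt) (S : WedgeIndex) :
    {s : HalfInt | s ∈ S.1 ∧ k.1 < s.1}.Finite := by
  obtain ⟨n, hn⟩ := k.2
  refine (S.2.1.union (HalfInt.finite_Icc n 1)).subset ?_
  rintro s ⟨hs, hk⟩
  by_cases hp : 0 < s.1
  · exact Or.inl ⟨hs, hp⟩
  · refine Or.inr ⟨?_, ?_⟩
    · rw [hn] at hk
      linarith
    · push_cast
      linarith

theorem wedgeSign_insert_of_lt {k l : HalfInt} {S : WedgeIndex} (hl : l ∉ S.1) (h : k.1 < l.1) :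
    wedgeSign k (S.insert l) = -wedgeSign k S := by
  have hset : {s : HalfInt | s ∈ (S.insert l).1 ∧ k.1 < s.1} =
      Insert.insert l {s : HalfInt | s ∈ S.1 ∧ k.1 < s.1} := by
    ext s
    constructor
    · rintro ⟨hs | hs, hk⟩
      · exact Or.inl hs
      · exact Or.inr ⟨hs, hk⟩
    · rintro (rfl | hs)
      · exact ⟨Or.inl rfl, h⟩
      · exact ⟨Or.inr hs.1, hs.2⟩
  unfold wedgeSign
  rw [hset, Set.ncard_insert_of_notMem (fun hs => hl hs.1) (finite_above k S), pow_succ]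
  ring

theorem wedgeSign_insert_of_le {k l : HalfInt} (S : WedgeIndex) (h : l.1 ≤ k.1) :
    wedgeSign k (S.insert l) = wedgeSign k S := by
  unfold wedgeSign
  congr 2
  ext s
  constructor
  · rintro ⟨hs | hs, hk⟩
    · subst hs
      exact absurd hk (not_lt.mpr h)
    · exact ⟨hs, hk⟩
  · rintro ⟨hs, hk⟩
    exact ⟨Or.inr hs, hk⟩

theorem erase_insert_self {l : HalfInt} {S : WedgeIndex} (hl : l ∈ S.1) :
    (S.erase l).insert l = S := (insert_eq_iff.mpr ⟨hl, rfl⟩).2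

theorem insert_erase_self {l : HalfInt} {S : WedgeIndex} (hl : l ∉ S.1) :
    (S.insert l).erase l = S := (insert_eq_iff.mp ⟨hl, rfl⟩).2

theorem notMem_erase (l : HalfInt) (S : WedgeIndex) : l ∉ (S.erase l).1 := fun h => h.2 rfl

theorem wedgeSign_erase_of_lt {k l : HalfInt} {S : WedgeIndex} (hl : l ∈ S.1) (h : k.1 < l.1) :
    wedgeSign k (S.erase l) = -wedgeSign k S := by
  have := wedgeSign_insert_of_lt (notMem_erase l S) h
  rw [erase_insert_self hl] at this
  rw [this, neg_neg]

theorem wedgeSign_erase_of_le {k l : HalfInt} {S : WedgeIndex} (hl : l ∈ S.1) (h : l.1 ≤ k.1) :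
    wedgeSign k (S.erase l) = wedgeSign k S := by
  have := wedgeSign_insert_of_le (S.erase l) h
  rwa [erase_insert_self hl, eq_comm] at this

theorem insert_comm (k l : HalfInt) (S : WedgeIndex) :
    (S.insert k).insert l = (S.insert l).insert k :=
  Subtype.ext (Set.insert_comm l k S.1)

theorem insert_erase_comm {k l : HalfInt} (h : k ≠ l) (S : WedgeIndex) :
    (S.insert k).erase l = (S.erase l).insert k := by
  refine Subtype.ext (Set.ext fun x => ?_)
  constructor
  · rintro ⟨hx | hx, hn⟩
    · exact Or.inl hx
    · exact Or.inr ⟨hx, hn⟩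
  · rintro (hx | hx)
    · exact ⟨Or.inl hx, fun hn => h (hx.symm.trans hn)⟩
    · exact ⟨Or.inr hx.1, hx.2⟩

theorem HalfInt.lt_or_gt_of_ne {k l : HalfInt} (h : k ≠ l) : k.1 < l.1 ∨ l.1 < k.1 :=
  _root_.lt_or_gt_of_ne fun e => h (Subtype.ext e)

theorem psi_mul_psiStar_self (k : HalfInt) : psi k * psiStar k + psiStar k * psi k = 1 := by
  refine wedge_end_ext fun S => ?_
  rw [LinearMap.add_apply, Module.End.mul_apply, Module.End.mul_apply, Module.End.one_apply]
  by_cases h : k ∈ S.1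
  · rw [psi_basisVec_of_mem h, map_zero, add_zero, psiStar_basisVec_of_mem h, map_smul,
      psi_basisVec_of_notMem (notMem_erase k S), erase_insert_self h, smul_smul,
      wedgeSign_erase_of_le h le_rfl, wedgeSign_mul_self, one_smul]
  · rw [psiStar_basisVec_of_notMem h, map_zero, zero_add, psi_basisVec_of_notMem h, map_smul,
      psiStar_basisVec_of_mem (Or.inl rfl), insert_erase_self h, smul_smul, wedgeSign_insert,
      wedgeSign_mul_self, one_smul]

/-- When both products are nonzero they reach the same basis vector. Altering the set at the larger
index flips the sign attached to the smaller one and not conversely, so the two contributions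
cancel. -/
theorem psi_mul_psiStar_of_ne {k l : HalfInt} (hkl : k ≠ l) :
    psi k * psiStar l + psiStar l * psi k = 0 := by
  refine wedge_end_ext fun S => ?_
  rw [LinearMap.add_apply, Module.End.mul_apply, Module.End.mul_apply, LinearMap.zero_apply]
  by_cases hk : k ∈ S.1
  · rw [psi_basisVec_of_mem hk, map_zero, add_zero]
    by_cases hl : l ∈ S.1
    · rw [psiStar_basisVec_of_mem hl, map_smul, psi_basisVec_of_mem (S := S.erase l) ⟨hk, hkl⟩,
        smul_zero]
    · rw [psiStar_basisVec_of_notMem hl, map_zero]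
  · rw [psi_basisVec_of_notMem hk, map_smul]
    by_cases hl : l ∈ S.1
    · rw [psiStar_basisVec_of_mem hl, map_smul, psi_basisVec_of_notMem (S := S.erase l) fun h => hk h.1,
        psiStar_basisVec_of_mem (Or.inr hl), insert_erase_comm hkl, smul_smul, smul_smul,
        ← add_smul]
      rcases HalfInt.lt_or_gt_of_ne hkl with h | h
      · rw [wedgeSign_erase_of_lt hl h, wedgeSign_insert_of_le S h.le]
        convert zero_smul ℂ _ using 2
        ring
      · rw [wedgeSign_erase_of_le hl h.le, wedgeSign_insert_of_lt hk h]
        convert zero_smul ℂ _ using 2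
        ring
    · rw [psiStar_basisVec_of_notMem hl, map_zero, psiStar_basisVec_of_notMem, smul_zero, add_zero]
      rintro (h | h)
      · exact hkl h.symm
      · exact hl h

theorem psiStar_mul_psiStar (k l : HalfInt) :
    psiStar k * psiStar l + psiStar l * psiStar k = 0 := by
  have zero_of_not : ∀ (k l : HalfInt) (S : WedgeIndex), ¬(k ∈ S.1 ∧ l ∈ S.1 ∧ k ≠ l) →
      psiStar k (psiStar l (basisVec S)) = 0 := by
    intro k l S h
    by_cases hl : l ∈ S.1
    · rw [psiStar_basisVec_of_mem hl, map_smul, psiStar_basisVec_of_notMem, smul_zero]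
      exact fun hk => h ⟨hk.1, hl, fun e => hk.2 e⟩
    · rw [psiStar_basisVec_of_notMem hl, map_zero]
  have anti : ∀ (k l : HalfInt) (S : WedgeIndex), k ∈ S.1 → l ∈ S.1 → k.1 < l.1 →
      psiStar k (psiStar l (basisVec S)) + psiStar l (psiStar k (basisVec S)) = 0 := by
    intro k l S hk hl h
    have hkl : k ≠ l := fun e => h.ne (congrArg Subtype.val e)
    have he : (S.erase l).erase k = (S.erase k).erase l := Subtype.ext (sdiff_right_comm _ _ _)
    rw [psiStar_basisVec_of_mem hl, map_smul, psiStar_basisVec_of_mem hk, map_smul,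
      psiStar_basisVec_of_mem (S := S.erase l) ⟨hk, hkl⟩,
      psiStar_basisVec_of_mem (S := S.erase k) ⟨hl, hkl.symm⟩,
      wedgeSign_erase_of_lt hl h, wedgeSign_erase_of_le hk h.le, he, smul_smul, smul_smul,
      ← add_smul]
    convert zero_smul ℂ _ using 2
    ring
  refine wedge_end_ext fun S => ?_
  rw [LinearMap.add_apply, Module.End.mul_apply, Module.End.mul_apply, LinearMap.zero_apply]
  by_cases h : k ∈ S.1 ∧ l ∈ S.1 ∧ k ≠ l
  · obtain ⟨hk, hl, hkl⟩ := h
    rcases HalfInt.lt_or_gt_of_ne hkl with h | h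
    · exact anti k l S hk hl h
    · rw [add_comm]
      exact anti l k S hl hk h
  · rw [zero_of_not k l S h, zero_of_not l k S fun h' => h ⟨h'.2.1, h'.1, h'.2.2.symm⟩, add_zero]

theorem finite_support_alpha {n : ℤ} (hn : n ≠ 0) (v : Wedge) :
    (Function.support fun k : HalfInt => psi (k.subInt n) (psiStar k v)).Finite := by
  induction v using Finsupp.induction_linear with
  | zero => simp
  | add f g hf hg =>
    refine (hf.union hg).subset ?_
    simp only [map_add]
    exact Function.support_add _ _
  | single S c =>
    have hS : (Finsupp.single S c : Wedge) = c • basisVec S := by simp [basisVec]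
    refine (alpha_support_finite hn S).subset ?_
    simp only [hS, map_smul]
    exact Function.support_const_smul_subset c _

theorem alpha_apply {n : ℤ} (hn : n ≠ 0) (v : Wedge) :
    alpha n v = ∑ᶠ k : HalfInt, psi (k.subInt n) (psiStar k v) := by
  induction v using Finsupp.induction_linear with
  | zero => simp
  | add f g hf hg =>
    rw [map_add, hf, hg, ← finsum_add_distrib (finite_support_alpha hn f)
      (finite_support_alpha hn g)]
    simp only [map_add]
  | single S c =>
    have hS : (Finsupp.single S c : Wedge) = c • basisVec S := by simp [basisVec]
    have hb : alpha n (basisVec S) = ∑ᶠ k : HalfInt, psi (k.subInt n) (psiStar k (basisVec S)) := by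
      simp [alpha, basisVec]
    rw [hS, map_smul, hb, smul_finsum]
    simp only [map_smul]

/-- The adjoint of `psiStar_mul_psiStar`, read off in matrix coefficients. -/
theorem psi_mul_psi (k l : HalfInt) : psi k * psi l + psi l * psi k = 0 := by
  refine LinearMap.ext fun v => Finsupp.ext fun S => ?_
  have h := congrArg (wedgeInner v) (congrArg (fun A => A (basisVec S)) (psiStar_mul_psiStar l k))
  rw [← wedgeInner_basisVec, ← wedgeInner_basisVec, LinearMap.add_apply, Module.End.mul_apply,
    Module.End.mul_apply, wedgeInner_add_left, wedgeInner_psi, wedgeInner_psi, wedgeInner_psi,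
    wedgeInner_psi, LinearMap.zero_apply, wedgeInner_zero_left]
  have wedgeInner_add_right : ∀ f g g' : Wedge,
      wedgeInner f (g + g') = wedgeInner f g + wedgeInner f g' := by
    intro f g g'
    simp [wedgeInner, mul_add]
  rw [← wedgeInner_add_right]
  refine h.trans ?_
  simp [wedgeInner]

/-- Moving `psi l` leftwards past the bilinear term `psi (k - n) * psiStar k` costs two signs, and
an extra term only for `k = l`. -/
theorem alpha_mul_psi {n : ℤ} (hn : n ≠ 0) (l : HalfInt) :
    alpha n * psi l = psi l * alpha n + psi (l.subInt n) := by
  classical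
  refine LinearMap.ext fun v => ?_
  rw [LinearMap.add_apply, Module.End.mul_apply, Module.End.mul_apply, alpha_apply hn,
    alpha_apply hn, map_finsum _ (finite_support_alpha hn v)]
  have term : ∀ k : HalfInt, psi (k.subInt n) (psiStar k (psi l v)) =
      psi l (psi (k.subInt n) (psiStar k v)) + if k = l then psi (l.subInt n) v else 0 := by
    intro k
    have h1 : psi (k.subInt n) (psi l (psiStar k v)) = -psi l (psi (k.subInt n) (psiStar k v)) :=
      eq_neg_of_add_eq_zero_left
        (congrArg (fun A => A (psiStar k v)) (psi_mul_psi (k.subInt n) l))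
    split_ifs with hkl
    · subst hkl
      have h2 : psiStar k (psi k v) = v - psi k (psiStar k v) :=
        eq_sub_of_add_eq' (congrArg (fun A => A v) (psi_mul_psiStar_self k))
      rw [h2, map_sub, h1, sub_neg_eq_add, add_comm]
    · have h2 : psiStar k (psi l v) = -psi l (psiStar k v) :=
        eq_neg_of_add_eq_zero_right
          (congrArg (fun A => A v) (psi_mul_psiStar_of_ne (Ne.symm hkl)))
      rw [h2, map_neg, h1, neg_neg, add_zero]
  simp only [term]
  have hfin : (Function.support fun k : HalfInt =>
      if k = l then psi (l.subInt n) v else 0).Finite :=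
    (Set.finite_singleton l).subset fun k hk => by
      by_contra h
      exact hk (if_neg h)
  rw [finsum_add_distrib _ hfin, finsum_eq_single _ l fun k hk => if_neg hk, if_pos rfl]
  refine (finite_support_alpha hn v).subset fun k hk h => hk ?_
  change psi l (psi (k.subInt n) (psiStar k v)) = 0
  rw [show psi (k.subInt n) (psiStar k v) = 0 from h, map_zero]

/-- Here the extra term arises from `psi (k - n)` meeting `psiStar l`, that is for `k = l + n`, and
it has a minus sign. -/
theorem alpha_mul_psiStar {n : ℤ} (hn : n ≠ 0) (l : HalfInt) :
    alpha n * psiStar l + psiStar (l.subInt (-n)) = psiStar l * alpha n := by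
  classical
  refine LinearMap.ext fun v => ?_
  rw [LinearMap.add_apply, Module.End.mul_apply, Module.End.mul_apply, alpha_apply hn,
    alpha_apply hn, map_finsum _ (finite_support_alpha hn v)]
  have shift : ∀ k : HalfInt, k.subInt n = l ↔ k = l.subInt (-n) := by
    intro k
    refine Subtype.ext_iff.trans (Iff.trans ?_ Subtype.ext_iff.symm)
    simp [HalfInt.subInt, sub_eq_iff_eq_add]
  have term : ∀ k : HalfInt, psi (k.subInt n) (psiStar k (psiStar l v)) =
      psiStar l (psi (k.subInt n) (psiStar k v)) +
        if k = l.subInt (-n) then -psiStar (l.subInt (-n)) v else 0 := by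
    intro k
    have h1 : psiStar k (psiStar l v) = -psiStar l (psiStar k v) :=
      eq_neg_of_add_eq_zero_left (congrArg (fun A => A v) (psiStar_mul_psiStar k l))
    rw [h1, map_neg]
    split_ifs with hkl
    · have h2 : psi (k.subInt n) (psiStar l (psiStar k v)) =
          psiStar k v - psiStar l (psi (k.subInt n) (psiStar k v)) := by
        rw [(shift k).mpr hkl]
        exact eq_sub_of_add_eq
          (congrArg (fun A => A (psiStar k v)) (psi_mul_psiStar_self l))
      rw [h2, ← hkl]
      abel
    · have h2 : psi (k.subInt n) (psiStar l (psiStar k v)) =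
          -psiStar l (psi (k.subInt n) (psiStar k v)) :=
        eq_neg_of_add_eq_zero_left (congrArg (fun A => A (psiStar k v))
          (psi_mul_psiStar_of_ne fun h => hkl ((shift k).mp h)))
      rw [h2, neg_neg, add_zero]
  simp only [term]
  have hfin : (Function.support fun k : HalfInt =>
      if k = l.subInt (-n) then -psiStar (l.subInt (-n)) v else 0).Finite :=
    (Set.finite_singleton (l.subInt (-n))).subset fun k hk => by
      by_contra h
      exact hk (if_neg h)
  rw [finsum_add_distrib _ hfin, finsum_eq_single _ (l.subInt (-n)) fun k hk => if_neg hk,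
    if_pos rfl, neg_add_cancel_right]
  refine (finite_support_alpha hn v).subset fun k hk h => hk ?_
  change psiStar l (psi (k.subInt n) (psiStar k v)) = 0
  rw [show psi (k.subInt n) (psiStar k v) = 0 from h, map_zero]

open scoped Classical in
/-- `ψ_q` for rational `q`, zero unless `q ∈ ℤ + 1/2`. -/
def psiRat (q : ℚ) : Module.End ℂ Wedge :=
  if h : ∃ n : ℤ, q = n + 1 / 2 then psi ⟨q, h⟩ else 0

open scoped Classical in
/-- `ψ*_q` for rational `q`, zero unless `q ∈ ℤ + 1/2`. -/
def psiStarRat (q : ℚ) : Module.End ℂ Wedge :=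
  if h : ∃ n : ℤ, q = n + 1 / 2 then psiStar ⟨q, h⟩ else 0

theorem psiRat_val (k : HalfInt) : psiRat k.1 = psi k := dif_pos k.2

theorem psiStarRat_val (k : HalfInt) : psiStarRat k.1 = psiStar k := dif_pos k.2

theorem psiRat_of_not {q : ℚ} (h : ¬∃ n : ℤ, q = n + 1 / 2) : psiRat q = 0 := dif_neg h

theorem psiStarRat_of_not {q : ℚ} (h : ¬∃ n : ℤ, q = n + 1 / 2) : psiStarRat q = 0 := dif_neg h

theorem not_halfInt_sub {q : ℚ} (h : ¬∃ n : ℤ, q = n + 1 / 2) (m : ℤ) :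
    ¬∃ n : ℤ, q - m = n + 1 / 2 := by
  rintro ⟨n, hn⟩
  refine h ⟨n + m, ?_⟩
  push_cast
  linarith

theorem alpha_mul_psiRat {n : ℤ} (hn : n ≠ 0) (q : ℚ) :
    alpha n * psiRat q = psiRat q * alpha n + psiRat (q - n) := by
  by_cases h : ∃ m : ℤ, q = m + 1 / 2
  · obtain ⟨k, rfl⟩ : ∃ k : HalfInt, k.1 = q := ⟨⟨q, h⟩, rfl⟩
    rw [psiRat_val, alpha_mul_psi hn, ← psiRat_val (k.subInt n)]
    rfl
  · rw [psiRat_of_not h, psiRat_of_not (not_halfInt_sub h n)]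
    simp

theorem alpha_mul_psiStarRat {n : ℤ} (hn : n ≠ 0) (q : ℚ) :
    alpha n * psiStarRat q + psiStarRat (q + n) = psiStarRat q * alpha n := by
  by_cases h : ∃ m : ℤ, q = m + 1 / 2
  · obtain ⟨k, rfl⟩ : ∃ k : HalfInt, k.1 = q := ⟨⟨q, h⟩, rfl⟩
    have e : k.1 + n = (k.subInt (-n)).1 := by simp [HalfInt.subInt]
    rw [e, psiStarRat_val, psiStarRat_val, alpha_mul_psiStar hn]
  · have h' := not_halfInt_sub h (-n)
    rw [Int.cast_neg, sub_neg_eq_add] at h'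
    rw [psiStarRat_of_not h, psiStarRat_of_not h', mul_zero, zero_mul, add_zero]

theorem alpha_mul_psiRat_mul_psiStarRat {n : ℤ} (hn : n ≠ 0) (q r : ℚ) :
    alpha n * (psiRat q * psiStarRat r) + psiRat q * psiStarRat (r + n) =
      psiRat q * psiStarRat r * alpha n + psiRat (q - n) * psiStarRat r := by
  rw [← mul_assoc, alpha_mul_psiRat hn, add_mul, mul_assoc, mul_assoc (psiRat q),
    ← alpha_mul_psiStarRat hn, mul_add, add_right_comm]

open scoped Classical in
theorem vacuum_expectation_psiRat_mul_psiStarRat (q r : ℚ) :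
    wedgeInner ((psiRat q * psiStarRat r) vacuum) vacuum =
      if (∃ n : ℤ, q = n + 1 / 2) ∧ q < 0 ∧ q = r then 1 else 0 := by
  by_cases hq : ∃ n : ℤ, q = n + 1 / 2
  swap
  · rw [psiRat_of_not hq, if_neg fun h => hq h.1, zero_mul, LinearMap.zero_apply,
      wedgeInner_zero_left]
  by_cases hr : ∃ n : ℤ, r = n + 1 / 2
  swap
  · rw [psiStarRat_of_not hr, if_neg, mul_zero, LinearMap.zero_apply, wedgeInner_zero_left]
    rintro ⟨_, _, rfl⟩
    exact hr hq
  obtain ⟨k, rfl⟩ : ∃ k : HalfInt, k.1 = q := ⟨⟨q, hq⟩, rfl⟩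
  obtain ⟨l, rfl⟩ : ∃ l : HalfInt, l.1 = r := ⟨⟨r, hr⟩, rfl⟩
  rw [psiRat_val, psiStarRat_val, Module.End.mul_apply]
  obtain ⟨S, hS, mem⟩ : ∃ S : WedgeIndex, vacuum = basisVec S ∧ ∀ k : HalfInt, k ∈ S.1 ↔ k.1 < 0 :=
    ⟨_, rfl, fun _ => Iff.rfl⟩
  rw [hS]
  rw [wedgeInner_basisVec]
  by_cases hl : l ∈ S.1
  · rw [psiStar_basisVec_of_mem hl, map_smul]
    by_cases hkl : k = l
    · subst hkl
      rw [psi_basisVec_of_notMem (notMem_erase k S), erase_insert_self hl, smul_smul,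
        wedgeSign_erase_of_le hl le_rfl, wedgeSign_mul_self, one_smul,
        if_pos ⟨hq, (mem k).mp hl, rfl⟩]
      simp [basisVec]
    · rw [if_neg fun h => hkl (Subtype.ext h.2.2)]
      by_cases hk : k ∈ (S.erase l).1
      · rw [psi_basisVec_of_mem hk]
        simp
      · rw [psi_basisVec_of_notMem hk]
        have hne : (S.erase l).insert k ≠ S := by
          intro h
          have : l ∈ ((S.erase l).insert k).1 := by rwa [h]
          rcases this with h1 | h1
          · exact hkl h1.symm
          · exact h1.2 rfl
        simp [basisVec, hne]
  · rw [psiStar_basisVec_of_notMem hl, map_zero, if_neg]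
    · rfl
    · rintro ⟨_, h0, h⟩
      exact hl ((mem l).mpr (h ▸ h0))

end Fermions

/-! ### Conjugation by `G`, the kernel in closed form, and its derivatives. -/

section Kernel

/-- The coefficient of `z^e.1 w^e.2` in `g(z,w) ψ(z) ψ*(w)`, where `ψ(z) = ∑ z^i ψ_i` and
`ψ*(w) = ∑ w^{-j} ψ*_j`. -/
def fermionPairing (e : ℚ × ℚ) : LaurentZW →ₗ[ℂ] Module.End ℂ Wedge :=
  Finsupp.linearCombination ℂ
      (fun a : ℚ × ℚ => psiRat (e.1 - a.1) * psiStarRat (a.2 - e.2)) ∘ₗ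
    (AddMonoidAlgebra.coeffLinearEquiv ℂ).toLinearMap

theorem fermionPairing_single (e : ℚ × ℚ) (a : ℚ × ℚ) (r : ℂ) :
    fermionPairing e (AddMonoidAlgebra.single a r) =
      r • (psiRat (e.1 - a.1) * psiStarRat (a.2 - e.2)) :=
  Finsupp.linearCombination_single ℂ r a

theorem fermionPairing_one (e : ℚ × ℚ) :
    fermionPairing e 1 = psiRat e.1 * psiStarRat (-e.2) := by
  rw [AddMonoidAlgebra.one_def, fermionPairing_single]
  simp

theorem alpha_mul_fermionPairing {n : ℤ} (hn : n ≠ 0) (e : ℚ × ℚ) (g : LaurentZW) :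
    alpha n * fermionPairing e g + fermionPairing e (monomialZW 0 n * g) =
      fermionPairing e g * alpha n + fermionPairing e (monomialZW n 0 * g) := by
  induction g using AddMonoidAlgebra.induction_linear with
  | zero => simp
  | add f g hf hg =>
    simp only [map_add, mul_add, add_mul]
    rw [add_add_add_comm, hf, hg, add_add_add_comm]
  | single a r =>
    rw [monomialZW, monomialZW, AddMonoidAlgebra.single_mul_single,
      AddMonoidAlgebra.single_mul_single, fermionPairing_single, fermionPairing_single,
      fermionPairing_single, mul_smul_comm, smul_mul_assoc, one_mul, ← smul_add, ← smul_add]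
    congr 1
    have h := alpha_mul_psiRat_mul_psiStarRat hn (e.1 - a.1) (a.2 - e.2)
    convert h using 4 <;> simp <;> ring

theorem alpha_commutator_fermionPairing {n : ℤ} (hn : n ≠ 0) (e : ℚ × ℚ) (g : LaurentZW) :
    alpha n * fermionPairing e g = fermionPairing e g * alpha n +
      fermionPairing e ((monomialZW n 0 - monomialZW 0 n) * g) := by
  have h := alpha_mul_fermionPairing hn e g
  have h2 : monomialZW n 0 * g = monomialZW 0 n * g + (monomialZW n 0 - monomialZW 0 n) * g := by
    ring
  rw [h2, map_add, add_left_comm, add_comm] at h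
  exact LinearMap.ext fun v => add_left_cancel (congrArg (fun A => A v) h)

/-- The exponent of the scalar factor produced by conjugation with `Γ₊`. -/
def plusExponent : MvPowerSeries Param LaurentZW :=
  linearSeries (fun n => monomialZW (n : ℕ) 0 - monomialZW 0 (n : ℕ)) 0

/-- The exponent of the scalar factor produced by conjugation with `Γ₋`. -/
def minusExponent : MvPowerSeries Param LaurentZW :=
  linearSeries 0 (fun n => monomialZW (-(n : ℕ)) 0 - monomialZW 0 (-(n : ℕ)))

theorem GammaPlus_mul_mapCoeff (e : ℚ × ℚ) (f : MvPowerSeries Param LaurentZW) :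
    GammaPlus * mapCoeff (fermionPairing e) f =
      mapCoeff (fermionPairing e) (formalExp plusExponent * f) * GammaPlus := by
  refine formalExp_mul_mapCoeff _ (isLinearSeries_linearSeries _ _)
    (isLinearSeries_linearSeries _ _) (linearSeries_mul_mapCoeff _ _ _ _ _ ?_) f
  rintro (n | n) g
  · have h := alpha_commutator_fermionPairing
      (n := (n : ℤ)) (by exact_mod_cast n.ne_zero) e g
    simpa using h
  · simp

theorem GammaMinus_mul_mapCoeff (e : ℚ × ℚ) (f : MvPowerSeries Param LaurentZW) :
    GammaMinus * mapCoeff (fermionPairing e) f =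
      mapCoeff (fermionPairing e) (formalExp minusExponent * f) * GammaMinus := by
  refine formalExp_mul_mapCoeff _ (isLinearSeries_linearSeries _ _)
    (isLinearSeries_linearSeries _ _) (linearSeries_mul_mapCoeff _ _ _ _ _ ?_) f
  rintro (n | n) g
  · simp
  · have h := alpha_commutator_fermionPairing
      (n := -(n : ℤ)) (neg_ne_zero.mpr (by exact_mod_cast n.ne_zero)) e g
    simpa using h

/-- The factors produced by $\Gamma_+$ and $\Gamma_-^{-1}$ combine to $J(z)/J(w)$; cross-multiplied,
this is an equality of exponents. -/
theorem formalExp_plusExponent_mul_Jw :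
    formalExp plusExponent * Jw = Jz * formalExp minusExponent := by
  unfold Jz Jw plusExponent minusExponent
  rw [← formalExp_add (isLinearSeries_linearSeries _ _) (isLinearSeries_linearSeries _ _),
    ← formalExp_add (isLinearSeries_linearSeries _ _) (isLinearSeries_linearSeries _ _),
    ← linearSeries_add, ← linearSeries_add]
  congr 2
  · ext1 n
    simp
  · ext1 n
    simp only [Pi.add_apply, Pi.zero_apply]
    abel

theorem G_mul_C_fermionPairing_one (e : ℚ × ℚ) :
    G * C (fermionPairing e 1) = mapCoeff (fermionPairing e) (Jz * Ring.inverse Jw) * G := by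
  have hGm : IsUnit GammaMinus := isUnit_formalExp _
  have hw : IsUnit Jw := isUnit_formalExp _
  have hm : IsUnit (formalExp minusExponent) := isUnit_formalExp _
  have h1 : Ring.inverse GammaMinus * C (fermionPairing e 1) =
      mapCoeff (fermionPairing e) (Ring.inverse (formalExp minusExponent)) *
        Ring.inverse GammaMinus := by
    -- Feeding in the inverse factor cancels it on the right, which yields the relation for the
    -- inverse of `GammaMinus`.
    have h := GammaMinus_mul_mapCoeff e (Ring.inverse (formalExp minusExponent))
    have h0 : mapCoeff (fermionPairing e) 1 = C (fermionPairing e 1) :=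
      (congrArg _ (map_one C).symm).trans
        (mapCoeff_C (S := LaurentZW) (R := Module.End ℂ Wedge) (fermionPairing e) 1)
    rw [Ring.mul_inverse_cancel _ hm, h0] at h
    have h' := congrArg (fun A => Ring.inverse GammaMinus * A * Ring.inverse GammaMinus) h
    rw [Ring.inverse_mul_cancel_left _ _ hGm, mul_assoc, Ring.mul_inverse_cancel_right _ _ hGm]
      at h'
    exact h'.symm
  have h2 : formalExp plusExponent * Ring.inverse (formalExp minusExponent) =
      Jz * Ring.inverse Jw := by
    refine hm.mul_right_cancel (hw.mul_right_cancel ?_)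
    rw [Ring.inverse_mul_cancel_right _ _ hm, formalExp_plusExponent_mul_Jw,
      mul_right_comm, Ring.inverse_mul_cancel_right _ _ hw]
  rw [G, mul_assoc, h1, ← mul_assoc, GammaPlus_mul_mapCoeff, h2, mul_assoc]

theorem Psi_mul_PsiStar (i j : HalfInt) :
    Psi i * PsiStar j = mapCoeff (fermionPairing (i.1, -j.1)) (Jz * Ring.inverse Jw) := by
  have h1 : fermionPairing (i.1, -j.1) 1 = psi i * psiStar j := by
    rw [fermionPairing_one, neg_neg, psiRat_val, psiStarRat_val]
  have h := G_mul_C_fermionPairing_one (i.1, -j.1)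
  rw [h1, map_mul] at h
  unfold Psi PsiStar
  rw [mul_assoc, mul_assoc G (C (psiStar j)), Ring.inverse_mul_cancel_left _ _ isUnit_G, mul_assoc,
    ← mul_assoc (C _), ← mul_assoc, h, Ring.mul_inverse_cancel_right _ _ isUnit_G]

/-- The vacuum expectation of `fermionPairing`. -/
def vacuumPairing (e : ℚ × ℚ) : LaurentZW →ₗ[ℂ] ℂ where
  toFun g := wedgeInner (fermionPairing e g vacuum) vacuum
  map_add' f g := by rw [map_add, LinearMap.add_apply, wedgeInner_add_left]
  map_smul' c f := by
    rw [map_smul, LinearMap.smul_apply, wedgeInner_smul_left, RingHom.id_apply, smul_eq_mul]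

theorem kernelGF_eq (e : ℚ × ℚ) :
    kernelGF e = mapCoeff (vacuumPairing e) (Jz * Ring.inverse Jw) := by
  classical
  unfold kernelGF
  by_cases h : ∃ i j : HalfInt, e = (i.1, -j.1)
  · obtain ⟨i, j, rfl⟩ := h
    rw [finsum_eq_single _ (i, j), if_pos rfl]
    · unfold K
      rw [Psi_mul_PsiStar]
      rfl
    · rintro ⟨i', j'⟩ hne
      refine if_neg fun h => hne ?_
      rw [Prod.mk.injEq, neg_inj] at h
      exact Prod.ext (Subtype.ext h.1.symm) (Subtype.ext h.2.symm)
  · have h1 : fermionPairing e 1 = 0 := by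
      rw [fermionPairing_one]
      by_cases hi : ∃ n : ℤ, e.1 = n + 1 / 2
      · rw [psiStarRat_of_not, mul_zero]
        intro hj
        exact h ⟨⟨e.1, hi⟩, ⟨-e.2, hj⟩, by simp⟩
      · rw [psiRat_of_not hi, zero_mul]
    -- At exponents outside the half-integers the left side is zero; as `G` is a unit, the whole
    -- series vanishes, without tracking which exponents occur in $J(z)/J(w)$.
    have h2 := G_mul_C_fermionPairing_one e
    rw [h1, map_zero, mul_zero, eq_comm, isUnit_G.mul_left_eq_zero] at h2
    rw [finsum_eq_zero_of_forall_eq_zero fun ij => if_neg fun he => h ⟨ij.1, ij.2, he⟩]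
    ext m
    rw [coeff_mapCoeff]
    change _ = wedgeInner (coeff m (mapCoeff (fermionPairing e) (Jz * Ring.inverse Jw)) vacuum) vacuum
    rw [h2, coeff_zero, coeff_zero, LinearMap.zero_apply, wedgeInner_zero_left]

theorem pderiv_mapCoeff (θ : LaurentZW →ₗ[ℂ] ℂ) (p : Param) (f : MvPowerSeries Param LaurentZW) :
    pderiv ℂ p (mapCoeff θ f) = mapCoeff θ (pderiv LaurentZW p f) := by
  ext m
  rw [coeff_pderiv, coeff_mapCoeff, coeff_mapCoeff, coeff_pderiv]
  have h : ∀ g : LaurentZW, g * ((m p : LaurentZW) + 1) = (m p + 1) • g := by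
    intro g
    rw [nsmul_eq_mul, mul_comm]
    push_cast
    rfl
  rw [h, map_nsmul, nsmul_eq_mul, mul_comm]
  push_cast
  rfl

theorem pderiv_Jz_mul_inverse_Jw (p : Param) {a b : LaurentZW}
    (ha : pderiv LaurentZW p Jz = C a * Jz) (hb : pderiv LaurentZW p Jw = C b * Jw) :
    pderiv LaurentZW p (Jz * Ring.inverse Jw) = C (a - b) * (Jz * Ring.inverse Jw) := by
  have hw : IsUnit Jw := isUnit_formalExp _
  -- Multiplying by `Jw` and differentiating $(J(z)/J(w))\,J(w)=J(z)$ avoids differentiating the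
  -- inverse.
  refine hw.mul_right_cancel ?_
  have h : (Jz * Ring.inverse Jw) * Jw = Jz := Ring.inverse_mul_cancel_right _ _ hw
  have h' := congrArg (pderiv LaurentZW p) h
  rw [Derivation.leibniz, ha, hb, smul_eq_mul, smul_eq_mul] at h'
  rw [map_sub]
  linear_combination h' - C a * h

theorem paramDeriv_kernelGF (p : Param) {a b c : LaurentZW}
    (ha : pderiv LaurentZW p Jz = C a * Jz) (hb : pderiv LaurentZW p Jw = C b * Jw)
    (h : ∀ e g, vacuumPairing e ((a - b) * g) = (c * g).coeff e) :
    paramDeriv p kernelGF = toTwoSided (C c * (Jz * Ring.inverse Jw)) := by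
  funext e
  unfold paramDeriv
  rw [kernelGF_eq, pderiv_mapCoeff, pderiv_Jz_mul_inverse_Jw p ha hb]
  ext m
  rw [coeff_mapCoeff, coeff_C_mul, h]
  change _ = (coeff m (C c * (Jz * Ring.inverse Jw))).coeff e
  rw [coeff_C_mul]

open scoped Classical in
theorem vacuumPairing_single (e a : ℚ × ℚ) (r : ℂ) :
    vacuumPairing e (AddMonoidAlgebra.single a r) =
      r * if (∃ n : ℤ, e.1 - a.1 = n + 1 / 2) ∧ e.1 - a.1 < 0 ∧ e.1 - a.1 = a.2 - e.2
        then 1 else 0 := by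
  change wedgeInner (fermionPairing e _ vacuum) vacuum = _
  rw [fermionPairing_single, LinearMap.smul_apply, wedgeInner_smul_left,
    vacuum_expectation_psiRat_mul_psiStarRat]

open scoped Classical in
-- On the line `q = s + 1` the conditions are `q < 1` and `q < 0` for half-integral `q`, so they
-- differ only at `q = 1 / 2`.
theorem negative_indicator_telescope (q s : ℚ) :
    ((if (∃ n : ℤ, q - 1 = n + 1 / 2) ∧ q - 1 < 0 ∧ q - 1 = s then 1 else 0) -
      if (∃ n : ℤ, q = n + 1 / 2) ∧ q < 0 ∧ q = s + 1 then 1 else 0 : ℂ) =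
      if q = 1 / 2 ∧ s = -(1 / 2) then 1 else 0 := by
  by_cases hs : q = s + 1
  swap
  · rw [if_neg fun h => hs (by linarith [h.2.2]), if_neg fun h => hs h.2.2,
      if_neg fun h => hs (by linarith [h.1, h.2]), sub_zero]
  by_cases hq : ∃ n : ℤ, q = n + 1 / 2
  swap
  · have hq' := not_halfInt_sub hq 1
    rw [Int.cast_one] at hq'
    rw [if_neg fun h => hq' h.1, if_neg fun h => hq h.1, if_neg, sub_zero]
    rintro ⟨h, _⟩
    exact hq ⟨0, by rw [h]; norm_num⟩
  obtain ⟨n, hn⟩ := hq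
  have hn' : ∃ n : ℤ, q - 1 = n + 1 / 2 := ⟨n - 1, by push_cast; linarith⟩
  rcases lt_trichotomy n 0 with h | h | h
  · have h1 : (n : ℚ) ≤ -1 := by exact_mod_cast Int.le_sub_one_of_lt h
    rw [if_pos ⟨hn', by linarith, by linarith⟩, if_pos ⟨⟨n, hn⟩, by linarith, hs⟩,
      if_neg fun h => by linarith [h.1], sub_self]
  · subst h
    rw [Int.cast_zero, zero_add] at hn
    rw [if_pos ⟨hn', by linarith, by linarith⟩, if_neg fun h => by linarith [h.2.1],
      if_pos ⟨hn, by linarith⟩, sub_zero]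
  · have h1 : (1 : ℚ) ≤ n := by exact_mod_cast h
    rw [if_neg fun h => by linarith [h.2.1], if_neg fun h => by linarith [h.2.1],
      if_neg fun h => by linarith [h.1], sub_self]

/-- The identity `(z - w) ∑_{i < 0} z^i w^{-i} = √(zw)`. -/
theorem vacuumPairing_z_sub_w (e : ℚ × ℚ) (g : LaurentZW) :
    vacuumPairing e ((monomialZW 1 0 - monomialZW 0 1) * g) =
      (monomialZW (1 / 2) (1 / 2) * g).coeff e := by
  classical
  induction g using AddMonoidAlgebra.induction_linear with
  | zero => simp
  | add f g hf hg =>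
    rw [mul_add, map_add, hf, hg, mul_add, AddMonoidAlgebra.coeff_add, Finsupp.add_apply]
  | single a r =>
    obtain ⟨x, y⟩ := e
    obtain ⟨a, b⟩ := a
    rw [sub_mul, map_sub, monomialZW, monomialZW, monomialZW, AddMonoidAlgebra.single_mul_single,
      AddMonoidAlgebra.single_mul_single, AddMonoidAlgebra.single_mul_single, vacuumPairing_single,
      vacuumPairing_single, AddMonoidAlgebra.coeff_single,
      Finsupp.single_apply, one_mul]
    have h := negative_indicator_telescope (x - a) (b - y)
    have e1 : x - (1 + a) = x - a - 1 := by ring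
    have e2 : 1 + b - y = b - y + 1 := by ring
    have e3 : (1 / 2 + a = x ∧ 1 / 2 + b = y) ↔ x - a = 1 / 2 ∧ b - y = -(1 / 2) := by
      constructor <;> rintro ⟨h, h'⟩ <;> constructor <;> linarith
    simp only [Prod.mk_add_mk, Prod.mk.injEq, zero_add, e1, e2, e3]
    rw [← mul_sub, h, mul_ite, mul_one, mul_zero]

/-- The identity `(w⁻¹ - z⁻¹) ∑_{i < 0} z^i w^{-i} = 1 / √(zw)`. -/
theorem vacuumPairing_w_inv_sub_z_inv (e : ℚ × ℚ) (g : LaurentZW) :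
    vacuumPairing e ((-monomialZW (-1) 0 - -monomialZW 0 (-1)) * g) =
      (monomialZW (-(1 / 2)) (-(1 / 2)) * g).coeff e := by
  -- Since $w^{-1}-z^{-1}=(z-w)(zw)^{-1}$, this is the preceding identity applied to $(zw)^{-1}g$.
  have h := vacuumPairing_z_sub_w e (monomialZW (-1) (-1) * g)
  have h1 : (monomialZW 1 0 - monomialZW 0 1) * (monomialZW (-1) (-1) * g) =
      (-monomialZW (-1) 0 - -monomialZW 0 (-1)) * g := by
    rw [← mul_assoc, sub_mul]
    congr 1
    simp only [monomialZW, AddMonoidAlgebra.single_mul_single, Prod.mk_add_mk]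
    norm_num
    abel
  have h2 : monomialZW (1 / 2) (1 / 2) * (monomialZW (-1) (-1) * g) =
      monomialZW (-(1 / 2)) (-(1 / 2)) * g := by
    rw [← mul_assoc]
    simp only [monomialZW, AddMonoidAlgebra.single_mul_single, Prod.mk_add_mk]
    norm_num
  rwa [h1, h2] at h

end Kernel

end SchurMeasure

open SchurMeasure in
theorem corollary2 :
    SchurMeasure.paramDeriv (Sum.inl 1) SchurMeasure.kernelGF =
        SchurMeasure.toTwoSided
          (MvPowerSeries.C (SchurMeasure.monomialZW (1 / 2) (1 / 2)) *
            (SchurMeasure.Jz * Ring.inverse SchurMeasure.Jw)) ∧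
      SchurMeasure.paramDeriv (Sum.inr 1) SchurMeasure.kernelGF =
        SchurMeasure.toTwoSided
          (MvPowerSeries.C (SchurMeasure.monomialZW (-(1 / 2)) (-(1 / 2))) *
            (SchurMeasure.Jz * Ring.inverse SchurMeasure.Jw)) := by
  refine ⟨?_, ?_⟩
  · refine paramDeriv_kernelGF _
      (pderiv_formalExp (isLinearSeries_linearSeries _ _) (pderiv_linearSeries _ _ _))
      (pderiv_formalExp (isLinearSeries_linearSeries _ _) (pderiv_linearSeries _ _ _)) ?_
    simpa using vacuumPairing_z_sub_w
  · refine paramDeriv_kernelGF _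
      (pderiv_formalExp (isLinearSeries_linearSeries _ _) (pderiv_linearSeries _ _ _))
      (pderiv_formalExp (isLinearSeries_linearSeries _ _) (pderiv_linearSeries _ _ _)) ?_
    simpa using vacuumPairing_w_inv_sub_z_inv

end
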